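/- Let $(\lambda_n)_{n\ge 1}$ be positive and $(q_n)_{n\ge 1}$ real, and let $J$ be the Jacobi operator in $\ell^2(\mathbb N)$, $\mathbb N=\{1,2,\dots\}$, given by $(Ju)(n)=\lambda_{n-1}u(n-1)+q_nu(n)+\lambda_nu(n+1)$ with $u(0)=0$, on the maximal domain $\{u\in\ell^2(\mathbb N): Ju\in\ell^2(\mathbb N)\}$. Let $e_n$ denote the canonical basis vectors. (i) Suppose that $J=J^*$, that $J$ is bounded from below by $d\in\mathbb R$, i.e. $\langle Ju,u\rangle\ge d\|u\|^2$ for all $u$ in the domain of $J$, and that $\lim_{n\to\infty}\lambda_n=+\infty$. Let $\lambda\in\mathbb C$ with $\operatorname{Re}\lambda<d$. Then $\lambda$ is in the resolvent set of $J$, and for every $\epsilon\in(0,1)$ there is $N=N(\epsilon,\lambda)\ge 1$ such that for all $n>N$ $$|\langle (J-\lambda)^{-1}e_1,e_n\rangle|\le \frac{1}{(d-\operatorname{Re}\lambda)\,\epsilon}\exp\Big(-(1-\epsilon)\sqrt{d-\operatorname{Re}\lambda}\,\sum_{k=N}^{n-1}\frac1{\sqrt{\lambda_k}}\Big).$$ (ii)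 The constant $1-\epsilon$ is sharp, in the sense that it cannot be replaced by $1+\epsilon$ for any $\epsilon>0$: for $\lambda_n=n$, $q_n=2n$ the operator $J$ satisfies all hypotheses of (i) with $d=1$, but for every real $\lambda<1$ and every $\epsilon>0$ there are no $C\in\mathbb R$ and $N\ge 1$ such that for all $n>N$ $$|\langle (J-\lambda)^{-1}e_1,e_n\rangle|\le C\exp\Big(-(1+\epsilon)\sqrt{1-\lambda}\,\sum_{k=N}^{n-1}\frac1{\sqrt{\lambda_k}}\Big).$$ -/

import Mathlib

/-- The complex Hilbert space of square-summable sequences. Coordinates are numbered from `0`, so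
the coordinate `n` is the one which is numbered `n + 1` when sequences start at `1`. -/
abbrev EllTwo : Type := lp (fun _ : ℕ => ℂ) 2

/-- The canonical basis vector. -/
noncomputable def ellBasis (n : ℕ) : EllTwo := lp.single 2 n (1 : ℂ)

/-- The Jacobi difference expression with weights `lam` (off-diagonal) and potential `q`
(diagonal): `lam n` is the entry at `(n, n + 1)` and `(n + 1, n)`, `q n` is the entry at `(n, n)`.
The first line is the boundary condition (no term to the left of the first coordinate). -/
def jacobiExpr (lam q : ℕ → ℝ) (u : ℕ → ℂ) : ℕ → ℂ
  | 0 => (q 0 : ℂ) * u 0 + (lam 0 : ℂ) * u 1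
  | n + 1 => (lam n : ℂ) * u n + (q (n + 1) : ℂ) * u (n + 1) + (lam (n + 1) : ℂ) * u (n + 2)

theorem jacobiExpr_add (lam q : ℕ → ℝ) (u v : ℕ → ℂ) :
    jacobiExpr lam q (u + v) = jacobiExpr lam q u + jacobiExpr lam q v := by
  funext n
  cases n <;> simp only [jacobiExpr, Pi.add_apply] <;> ring

theorem jacobiExpr_smul (lam q : ℕ → ℝ) (c : ℂ) (u : ℕ → ℂ) :
    jacobiExpr lam q (c • u) = c • jacobiExpr lam q u := by
  funext n
  cases n <;> simp only [jacobiExpr, Pi.smul_apply, smul_eq_mul] <;> ring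

theorem jacobiExpr_zero (lam q : ℕ → ℝ) : jacobiExpr lam q 0 = 0 := by
  funext n
  cases n <;> simp [jacobiExpr]

/-- The domain of the Jacobi operator: all square-summable `u` for which the difference expression
is square-summable. -/
def jacobiDomain (lam q : ℕ → ℝ) : Submodule ℂ EllTwo where
  carrier := {u | Memℓp (jacobiExpr lam q u) 2}
  zero_mem' := by
    simp only [Set.mem_ofPred_eq, lp.coeFn_zero, jacobiExpr_zero]
    exact zero_memℓp
  add_mem' := by
    intro u v hu hv
    simp only [Set.mem_ofPred_eq, lp.coeFn_add, jacobiExpr_add] at *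
    exact hu.add hv
  smul_mem' := by
    intro c u hu
    simp only [Set.mem_ofPred_eq, lp.coeFn_smul, jacobiExpr_smul] at *
    exact hu.const_smul c

/-- The operator in `ℓ²` that the Jacobi matrix with weights `lam` and potential `q` defines on
its maximal domain. It is the adjoint of the matrix on finitely supported sequences; hence it is
self-adjoint exactly when the matrix is essentially self-adjoint on these, and then it is the
unique self-adjoint operator associated with the matrix. -/
noncomputable def jacobiOp (lam q : ℕ → ℝ) : EllTwo →ₗ.[ℂ] EllTwo where
  domain := jacobiDomain lam q
  toFun :=
    { toFun := fun u => ⟨jacobiExpr lam q (u : EllTwo), u.2⟩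
      map_add' := fun u v => Subtype.ext (jacobiExpr_add lam q (u : EllTwo) (v : EllTwo))
      map_smul' := fun c u => Subtype.ext (jacobiExpr_smul lam q c (u : EllTwo)) }

/-- `T` is bounded from below by `d`: `⟨T u, u⟩ ≥ d ‖u‖²` on the domain. -/
def IsBoundedBelowBy (T : EllTwo →ₗ.[ℂ] EllTwo) (d : ℝ) : Prop :=
  ∀ u : T.domain, d * ‖(u : EllTwo)‖ ^ 2 ≤ (inner ℂ (u : EllTwo) (T u)).re

/-- The bounded operator `R` is the resolvent `(T - z)⁻¹`: it maps into the domain of `T` and is a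
two-sided inverse of `T - z`. Such an `R` is unique, and exists iff `z` is in the resolvent set. -/
def IsResolventOf (T : EllTwo →ₗ.[ℂ] EllTwo) (z : ℂ) (R : EllTwo →L[ℂ] EllTwo) : Prop :=
  (∀ f : EllTwo, ∃ h : R f ∈ T.domain, T ⟨R f, h⟩ - z • R f = f) ∧
  (∀ u : T.domain, R (T u - z • (u : EllTwo)) = (u : EllTwo))

/-! The lower bound makes `J - z` coercive, so its range is closed. A vector orthogonal to the range
is an eigenvector of the maximal operator at `conj z`, which coercivity excludes; so the resolvent
exists.

Decay is an Agmon (Combes–Thomas) estimate. For `u = (J - z)⁻¹ e₀` and a weight `φ`, passing from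
`Re ⟨φ²u, Ju⟩` to `⟨φu, Jφu⟩` costs only terms with `lam k * (φ (k+1) - φ k)²`. If these are at most
`κ * φ k * φ (k+1)` with `κ < d - Re z`, then `φu` is bounded in norm (`norm_weight_mul_le`). The
weight `exp (c ∑ 1/√lam)` qualifies far out because `lam → ∞`.

For sharpness, the Wronskian of `u` with a solution built from Laguerre polynomials is constant
(`laguerre_wronskian`). That solution grows at most like `exp (2√(sn))`, `s = 1 - x`, while `∑ 1/√k`
grows like `2√n`, so `u` cannot decay at a faster rate. -/

open Filter Topology

/-! ### Lagrange's identity and the basis vectors -/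

/-- Symmetry of the matrix makes the sum telescope. The form is bilinear, so conjugates are inserted
by the user; this one identity gives adjointness and the Wronskian. -/
theorem jacobiExpr_lagrange (lam q : ℕ → ℝ) (u v : ℕ → ℂ) (n : ℕ) :
    ∑ k ∈ Finset.range (n + 1), (v k * jacobiExpr lam q u k - u k * jacobiExpr lam q v k) =
      lam n * (v n * u (n + 1) - v (n + 1) * u n) := by
  induction n with
  | zero => simp [jacobiExpr]; ring
  | succ n ih => rw [Finset.sum_range_succ, ih]; simp only [jacobiExpr]; ring

theorem jacobiExpr_conj (lam q : ℕ → ℝ) (u : ℕ → ℂ) (n : ℕ) :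
    jacobiExpr lam q (fun k => starRingEnd ℂ (u k)) n = starRingEnd ℂ (jacobiExpr lam q u n) := by
  cases n <;> simp [jacobiExpr]

theorem jacobiOp_coe_apply (lam q : ℕ → ℝ) (u : (jacobiOp lam q).domain) (n : ℕ) :
    (jacobiOp lam q u : EllTwo) n = jacobiExpr lam q (u : EllTwo) n := rfl

theorem mem_jacobiOp_domain {lam q : ℕ → ℝ} {u : EllTwo} :
    u ∈ (jacobiOp lam q).domain ↔ Memℓp (jacobiExpr lam q u) 2 := Iff.rfl

theorem ellBasis_apply (n k : ℕ) : (ellBasis n : EllTwo) k = if k = n then 1 else 0 := by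
  simp [ellBasis, Pi.single_apply]

theorem inner_ellBasis_left (n : ℕ) (f : EllTwo) : inner ℂ (ellBasis n) f = f n := by
  simp [ellBasis, lp.inner_single_left]

theorem norm_inner_ellBasis_right (n : ℕ) (f : EllTwo) : ‖inner ℂ f (ellBasis n)‖ = ‖f n‖ := by
  rw [norm_inner_symm, inner_ellBasis_left]

theorem memℓp_of_eventually_zero {u : ℕ → ℂ} {N : ℕ} (h : ∀ n, N ≤ n → u n = 0) :
    Memℓp u 2 := by
  refine (memℓp_zero ?_ : Memℓp u 0).of_exponent_ge (by simp)
  refine (Set.finite_lt_nat N).subset fun n hn => ?_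
  by_contra hlt
  exact hn (h n (by simpa using hlt))

theorem jacobiExpr_eq_zero_of_eventually_zero {lam q u} {N : ℕ} (h : ∀ n, N ≤ n → u n = 0)
    (n : ℕ) (hn : N + 1 ≤ n) : jacobiExpr lam q u n = 0 := by
  obtain ⟨m, rfl⟩ : ∃ m, n = m + 1 := ⟨n - 1, by omega⟩
  simp [jacobiExpr, h m (by omega), h (m + 1) (by omega), h (m + 2) (by omega)]

theorem ellBasis_mem_domain (lam q : ℕ → ℝ) (n : ℕ) :
    ellBasis n ∈ (jacobiOp lam q).domain :=
  memℓp_of_eventually_zero (N := n + 2) <| jacobiExpr_eq_zero_of_eventually_zero (N := n + 1)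
    fun k hk => by rw [ellBasis_apply, if_neg (by omega)]

/-- Partial sums of the inner product. -/
theorem tendsto_sum_conj_mul (u v : EllTwo) :
    Tendsto (fun n => ∑ k ∈ Finset.range (n + 1), starRingEnd ℂ (u k) * v k) atTop
      (𝓝 (inner ℂ u v)) := by
  have := (lp.hasSum_inner (𝕜 := ℂ) u v).tendsto_sum_nat
  simpa [Function.comp_def, mul_comm] using this.comp (tendsto_add_atTop_nat 1)

theorem inner_jacobiOp_ellBasis (lam q : ℕ → ℝ) (f : EllTwo) (n : ℕ) :
    inner ℂ f (jacobiOp lam q ⟨ellBasis n, ellBasis_mem_domain lam q n⟩) =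
      starRingEnd ℂ (jacobiExpr lam q f n) := by
  refine tendsto_nhds_unique (tendsto_sum_conj_mul f _) ?_
  refine tendsto_const_nhds.congr' ?_
  filter_upwards [eventually_ge_atTop (n + 1)] with m hm
  have h := jacobiExpr_lagrange lam q (ellBasis n : EllTwo) (fun k => starRingEnd ℂ (f k)) m
  rw [ellBasis_apply, ellBasis_apply, if_neg (by omega), if_neg (by omega), mul_zero, mul_zero,
    sub_zero, mul_zero, Finset.sum_sub_distrib, sub_eq_zero] at h
  simp only [jacobiOp_coe_apply]
  rw [h]
  simp only [ellBasis_apply, ite_mul, one_mul, zero_mul, Finset.sum_ite_eq', Finset.mem_range,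
    jacobiExpr_conj]
  rw [if_pos (by omega)]

/-! ### The resolvent below the lower bound -/

section Resolvent

variable {lam q : ℕ → ℝ} {d : ℝ} {z : ℂ}

theorem IsBoundedBelowBy.norm_le {T : EllTwo →ₗ.[ℂ] EllTwo} (hT : IsBoundedBelowBy T d)
    (u : T.domain) : (d - z.re) * ‖(u : EllTwo)‖ ≤ ‖T u - z • (u : EllTwo)‖ := by
  rcases (norm_nonneg (u : EllTwo)).eq_or_lt with h0 | h0
  · rw [← h0]; simp
  refine le_of_mul_le_mul_right ?_ h0
  have h1 := hT u
  have h2 : (inner ℂ (u : EllTwo) (T u - z • (u : EllTwo))).re ≤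
      ‖(u : EllTwo)‖ * ‖T u - z • (u : EllTwo)‖ :=
    (Complex.re_le_norm _).trans (norm_inner_le_norm _ _)
  have h3 : inner ℂ (u : EllTwo) (u : EllTwo) = ((‖(u : EllTwo)‖ ^ 2 : ℝ) : ℂ) := by
    rw [inner_self_eq_norm_sq_to_K, Complex.ofReal_pow]; rfl
  rw [inner_sub_right, inner_smul_right, h3, Complex.sub_re, Complex.re_mul_ofReal] at h2
  nlinarith

/-- The operator `T - z` on the domain of `T`. -/
noncomputable def LinearPMap.shift (T : EllTwo →ₗ.[ℂ] EllTwo) (z : ℂ) : T.domain →ₗ[ℂ] EllTwo :=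
  T.toFun - z • T.domain.subtype

theorem LinearPMap.shift_apply (T : EllTwo →ₗ.[ℂ] EllTwo) (z : ℂ) (u : T.domain) :
    T.shift z u = T u - z • (u : EllTwo) := rfl

theorem tendsto_coord {f : ℕ → EllTwo} {g : EllTwo} (h : Tendsto f atTop (𝓝 g)) (k : ℕ) :
    Tendsto (fun n => f n k) atTop (𝓝 (g k)) := by
  simp only [← inner_ellBasis_left]
  exact tendsto_const_nhds.inner h

/-- Coercivity makes the preimages Cauchy. Each row has at most three entries, so the expression
passes to the limit coordinatewise, and maximality of the domain admits the limit. -/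
theorem jacobiOp_shift_isClosed_range (hb : IsBoundedBelowBy (jacobiOp lam q) d)
    (hz : z.re < d) : IsClosed (Set.range ((jacobiOp lam q).shift z)) := by
  refine isClosed_of_closure_subset fun f hf => ?_
  obtain ⟨g, hg, hgf⟩ := mem_closure_iff_seq_limit.1 hf
  choose u hu using hg
  have hcauchy : CauchySeq fun n => (u n : EllTwo) := by
    refine Metric.cauchySeq_iff'.2 fun ε hε => ?_
    obtain ⟨N, hN⟩ := Metric.cauchySeq_iff'.1 hgf.cauchySeq ((d - z.re) * ε)
      (mul_pos (sub_pos.2 hz) hε)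
    refine ⟨N, fun n hn => ?_⟩
    have h1 := hN n hn
    rw [dist_eq_norm, ← hu, ← hu, ← map_sub, LinearPMap.shift_apply] at h1
    have h2 := (hb.norm_le (z := z) (u n - u N)).trans_lt h1
    rw [dist_eq_norm]
    exact lt_of_mul_lt_mul_left h2 (sub_pos.2 hz).le
  obtain ⟨v, hv⟩ := cauchySeq_tendsto_of_complete hcauchy
  have hcoord := tendsto_coord hv
  have hJ : jacobiExpr lam q v = ⇑(f + z • v) := by
    funext k
    have h1 : Tendsto (fun n => jacobiExpr lam q (u n : EllTwo) k) atTop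
        (𝓝 (jacobiExpr lam q v k)) := by
      cases k with
      | zero => exact ((hcoord 0).const_mul _).add ((hcoord 1).const_mul _)
      | succ k =>
        exact (((hcoord k).const_mul _).add ((hcoord (k + 1)).const_mul _)).add
          ((hcoord (k + 2)).const_mul _)
    refine tendsto_nhds_unique h1 ?_
    refine (tendsto_coord (hgf.add (hv.const_smul z)) k).congr fun n => ?_
    rw [← hu, LinearPMap.shift_apply, sub_add_cancel, jacobiOp_coe_apply]
  have hmem : v ∈ (jacobiOp lam q).domain := by
    rw [mem_jacobiOp_domain, hJ]
    exact lp.memℓp _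
  refine ⟨⟨v, hmem⟩, ?_⟩
  rw [LinearPMap.shift_apply, sub_eq_iff_eq_add]
  exact lp.ext hJ

theorem jacobiOp_shift_range (hb : IsBoundedBelowBy (jacobiOp lam q) d)
    (hz : z.re < d) : LinearMap.range ((jacobiOp lam q).shift z) = ⊤ := by
  set K := LinearMap.range ((jacobiOp lam q).shift z) with hK
  have hclosed : IsClosed (K : Set EllTwo) := by
    rw [hK, LinearMap.coe_range]
    exact jacobiOp_shift_isClosed_range hb hz
  have : CompleteSpace K := hclosed.completeSpace_coe
  rw [← Submodule.orthogonal_eq_bot_iff, Submodule.eq_bot_iff]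
  intro f hf
  -- Testing against the images of basis vectors turns orthogonality into the eigenvalue equation at
  -- `conj z`.
  have hJ : jacobiExpr lam q f = ⇑(starRingEnd ℂ z • f) := by
    funext n
    have h := Submodule.inner_left_of_mem_orthogonal
      (LinearMap.mem_range_self ((jacobiOp lam q).shift z) ⟨_, ellBasis_mem_domain lam q n⟩) hf
    rw [LinearPMap.shift_apply, inner_sub_right, inner_jacobiOp_ellBasis, inner_smul_right,
      sub_eq_zero, ← inner_conj_symm, inner_ellBasis_left] at h
    simpa using congrArg (starRingEnd ℂ) h
  have hmem : f ∈ (jacobiOp lam q).domain := by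
    rw [mem_jacobiOp_domain, hJ]
    exact lp.memℓp _
  have h := hb.norm_le (z := starRingEnd ℂ z) ⟨f, hmem⟩
  have h0 : jacobiOp lam q ⟨f, hmem⟩ = starRingEnd ℂ z • f := lp.ext hJ
  rw [h0, sub_self, norm_zero, Complex.conj_re] at h
  exact norm_le_zero_iff.1 (nonpos_of_mul_nonpos_right h (sub_pos.2 hz))

theorem exists_isResolventOf (hb : IsBoundedBelowBy (jacobiOp lam q) d) (hz : z.re < d) :
    ∃ R : EllTwo →L[ℂ] EllTwo, IsResolventOf (jacobiOp lam q) z R := by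
  have hinj : Function.Injective ((jacobiOp lam q).shift z) := by
    refine (injective_iff_map_eq_zero _).2 fun u hu => ?_
    have h := hb.norm_le (z := z) u
    rw [← LinearPMap.shift_apply, hu, norm_zero] at h
    exact Subtype.ext (norm_le_zero_iff.1 (nonpos_of_mul_nonpos_right h (sub_pos.2 hz)))
  let e := LinearEquiv.ofBijective _
    ⟨hinj, LinearMap.range_eq_top.1 (jacobiOp_shift_range hb hz)⟩
  have he : ∀ u, e u = jacobiOp lam q u - z • (u : EllTwo) := fun u => rfl
  refine ⟨((jacobiOp lam q).domain.subtype ∘ₗ e.symm.toLinearMap).mkContinuous (d - z.re)⁻¹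
    fun f => ?_, fun f => ⟨(e.symm f).2, ?_⟩, fun u => ?_⟩
  · have h := hb.norm_le (z := z) (e.symm f)
    rw [← he, e.apply_symm_apply] at h
    exact (le_inv_mul_iff₀ (sub_pos.2 hz)).2 h
  · exact (he _).symm.trans (e.apply_symm_apply f)
  · exact congrArg Subtype.val (e.symm_apply_apply u)

end Resolvent

/-! ### The weighted estimate and exponential decay -/

/-- The quadratic form of the Jacobi expression under multiplication by a real weight. -/
theorem jacobiExpr_weight_identity (lam q : ℕ → ℝ) (φ : ℕ → ℝ) (u : ℕ → ℂ) (n : ℕ) :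
    ∑ k ∈ Finset.range (n + 1),
        (starRingEnd ℂ (φ k * u k) * jacobiExpr lam q (fun j => φ j * u j) k -
          starRingEnd ℂ (φ k * (φ k * u k)) * jacobiExpr lam q u k).re =
      -∑ k ∈ Finset.range n,
          lam k * (φ (k + 1) - φ k) ^ 2 * (starRingEnd ℂ (u k) * u (k + 1)).re +
        lam n * (φ n * (φ (n + 1) - φ n)) * (starRingEnd ℂ (u n) * u (n + 1)).re := by
  induction n with
  | zero =>
    simp [jacobiExpr, Complex.mul_re, Complex.mul_im]
    ring
  | succ n ih =>
    rw [Finset.sum_range_succ, ih, Finset.sum_range_succ]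
    simp [jacobiExpr, Complex.mul_re, Complex.mul_im]
    ring

theorem sum_norm_mul_norm_succ_le (v : EllTwo) (n : ℕ) :
    ∑ k ∈ Finset.range n, ‖v k‖ * ‖v (k + 1)‖ ≤ ‖v‖ ^ 2 := by
  have hs := lp.hasSum_norm (p := 2) (by norm_num) v
  norm_num at hs
  have h1 : ∑ k ∈ Finset.range n, ‖v k‖ ^ 2 ≤ ‖v‖ ^ 2 :=
    sum_le_hasSum _ (fun _ _ => by positivity) hs
  have h2 : ∑ k ∈ Finset.range n, ‖v (k + 1)‖ ^ 2 ≤ ‖v‖ ^ 2 := by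
    have h3 : ∑ k ∈ Finset.range (n + 1), ‖v k‖ ^ 2 ≤ ‖v‖ ^ 2 :=
      sum_le_hasSum _ (fun _ _ => by positivity) hs
    rw [Finset.sum_range_succ'] at h3
    nlinarith [sq_nonneg ‖v 0‖]
  have h4 : ∑ k ∈ Finset.range n, ‖v k‖ * ‖v (k + 1)‖ ≤
      ∑ k ∈ Finset.range n, (‖v k‖ ^ 2 + ‖v (k + 1)‖ ^ 2) / 2 :=
    Finset.sum_le_sum fun k _ => by nlinarith [sq_nonneg (‖v k‖ - ‖v (k + 1)‖)]
  rw [← Finset.sum_div, Finset.sum_add_distrib] at h4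
  linarith

/-- A weighted `ℓ²` bound for a solution of `(J - z) u = e₀`, for an eventually constant weight of
which the logarithmic steps are small. -/
theorem norm_weight_mul_le {lam q : ℕ → ℝ} {d κ : ℝ} {z : ℂ} (hlam : ∀ n, 0 < lam n)
    (hb : IsBoundedBelowBy (jacobiOp lam q) d)
    (u : (jacobiOp lam q).domain)
    (hu : jacobiOp lam q u - z • (u : EllTwo) = ellBasis 0)
    (φ : ℕ → ℝ) (M : ℕ) (hφpos : ∀ n, 0 < φ n) (hφ0 : φ 0 = 1)
    (hφM : ∀ n, M ≤ n → φ n = φ M) (hκ0 : 0 ≤ κ) (hκ : κ < d - z.re)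
    (hstep : ∀ n, lam n * (φ (n + 1) - φ n) ^ 2 ≤ κ * (φ n * φ (n + 1))) (n : ℕ) :
    (d - z.re - κ) * (φ n * ‖(u : EllTwo) n‖) ≤ 1 := by
  -- Split `φ` into `φ - φ M`, which has finite support, and the constant `φ M`.
  have hmul : ∀ {w : ℕ → ℂ}, Memℓp w 2 → Memℓp (fun n => (φ n : ℂ) * w n) 2 := by
    intro w hw
    have h1 : Memℓp (fun n => ((φ n - φ M : ℝ) : ℂ) * w n) 2 :=
      memℓp_of_eventually_zero (N := M) fun n hn => by simp [hφM n hn]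
    convert h1.add (hw.const_mul (φ M : ℂ)) using 1
    funext n
    simp only [Pi.add_apply]
    push_cast
    ring
  have hu0 : Memℓp (u : EllTwo) 2 := lp.memℓp _
  let v : EllTwo := ⟨_, hmul hu0⟩
  let w : EllTwo := ⟨_, hmul (hmul hu0)⟩
  have hv : ∀ n, v n = φ n * (u : EllTwo) n := fun _ => rfl
  have hw : ∀ n, w n = φ n * (φ n * (u : EllTwo) n) := fun _ => rfl
  have hvdom : v ∈ (jacobiOp lam q).domain := by
    have h1 : Memℓp (fun n => ((φ n - φ M : ℝ) : ℂ) * (u : EllTwo) n) 2 :=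
      memℓp_of_eventually_zero (N := M) fun n hn => by simp [hφM n hn]
    have h2 : (⟨_, h1⟩ : EllTwo) ∈ (jacobiOp lam q).domain :=
      memℓp_of_eventually_zero <| jacobiExpr_eq_zero_of_eventually_zero (N := M)
        fun n hn => by simp [hφM n hn]
    have h3 := Submodule.add_mem _ h2 (Submodule.smul_mem _ (φ M : ℂ) u.2)
    convert h3 using 1
    refine lp.ext (funext fun n => ?_)
    rw [hv, lp.coeFn_add, lp.coeFn_smul]
    simp only [Pi.add_apply, Pi.smul_apply, smul_eq_mul]
    push_cast
    ring
  have hlow := hb ⟨v, hvdom⟩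
  have hJu : jacobiOp lam q u = ellBasis 0 + z • (u : EllTwo) := sub_eq_iff_eq_add.1 hu
  have hvw : inner ℂ w (u : EllTwo) = ((‖v‖ ^ 2 : ℝ) : ℂ) := by
    have h1 : inner ℂ v v = ((‖v‖ ^ 2 : ℝ) : ℂ) := by
      rw [inner_self_eq_norm_sq_to_K, Complex.ofReal_pow]; rfl
    rw [← h1, lp.inner_eq_tsum, lp.inner_eq_tsum]
    refine tsum_congr fun n => ?_
    simp only [RCLike.inner_apply, hv, hw, map_mul, Complex.conj_ofReal]
    ring
  have hwJ : inner ℂ w (jacobiOp lam q u) = starRingEnd ℂ (v 0) + z * ((‖v‖ ^ 2 : ℝ) : ℂ) := by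
    rw [hJu, inner_add_right, inner_smul_right, hvw, ← inner_conj_symm, inner_ellBasis_left, hw,
      hv, hφ0]
    simp
  have hdiff : (inner ℂ v (jacobiOp lam q ⟨v, hvdom⟩) - inner ℂ w (jacobiOp lam q u)).re ≤
      κ * ‖v‖ ^ 2 := by
    have hlim := (Complex.continuous_re.tendsto _).comp
      ((tendsto_sum_conj_mul v (jacobiOp lam q ⟨v, hvdom⟩)).sub
        (tendsto_sum_conj_mul w (jacobiOp lam q u)))
    refine le_of_tendsto hlim ?_
    filter_upwards [eventually_ge_atTop M] with m hm
    have hid := jacobiExpr_weight_identity lam q φ (u : EllTwo) m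
    -- The weight is constant past `M`, so the boundary term vanishes.
    rw [hφM m hm, hφM (m + 1) (by omega), sub_self, mul_zero, mul_zero, zero_mul, add_zero,
      ← Complex.re_sum, Finset.sum_sub_distrib] at hid
    refine hid.trans_le ?_
    rw [← Finset.sum_neg_distrib]
    refine le_trans ?_ (mul_le_mul_of_nonneg_left (sum_norm_mul_norm_succ_le v m) hκ0)
    rw [Finset.mul_sum]
    refine Finset.sum_le_sum fun k _ => ?_
    have h1 : -(starRingEnd ℂ ((u : EllTwo) k) * (u : EllTwo) (k + 1)).re ≤
        ‖(u : EllTwo) k‖ * ‖(u : EllTwo) (k + 1)‖ := by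
      refine (neg_le_abs _).trans ((Complex.abs_re_le_norm _).trans ?_)
      rw [norm_mul, RCLike.norm_conj]
    have h2 : 0 ≤ lam k * (φ (k + 1) - φ k) ^ 2 := by have := hlam k; positivity
    have h3 : ∀ n, ‖v n‖ = φ n * ‖(u : EllTwo) n‖ := fun n => by
      rw [hv, norm_mul, Complex.norm_of_nonneg (hφpos n).le]
    rw [h3, h3]
    calc _ = lam k * (φ (k + 1) - φ k) ^ 2 *
          -(starRingEnd ℂ ((u : EllTwo) k) * (u : EllTwo) (k + 1)).re := by ring
      _ ≤ lam k * (φ (k + 1) - φ k) ^ 2 * (‖(u : EllTwo) k‖ * ‖(u : EllTwo) (k + 1)‖) :=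
        mul_le_mul_of_nonneg_left h1 h2
      _ ≤ κ * (φ k * φ (k + 1)) * (‖(u : EllTwo) k‖ * ‖(u : EllTwo) (k + 1)‖) :=
        mul_le_mul_of_nonneg_right (hstep k) (by positivity)
      _ = _ := by ring
  have hvn : ∀ n, ‖v n‖ ≤ ‖v‖ := fun n => lp.norm_apply_le_norm (by norm_num) v n
  have hv0 : (starRingEnd ℂ (v 0)).re ≤ ‖v‖ :=
    (Complex.re_le_norm _).trans ((RCLike.norm_conj _).trans_le (hvn 0))
  rw [hwJ, Complex.sub_re, Complex.add_re, Complex.re_mul_ofReal] at hdiff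
  have hkey : (d - z.re - κ) * ‖v‖ ≤ 1 := by
    rcases (norm_nonneg v).eq_or_lt with h0 | h0
    · rw [← h0]; simp
    · refine le_of_mul_le_mul_right ?_ h0
      have hlow' : d * ‖v‖ ^ 2 ≤ (inner ℂ v (jacobiOp lam q ⟨v, hvdom⟩)).re := hlow
      nlinarith
  have h := hvn n
  rw [hv, norm_mul, Complex.norm_of_nonneg (hφpos n).le] at h
  exact (mul_le_mul_of_nonneg_left h (by linarith)).trans hkey

/-- This is `1 - exp (-t) ≤ t`, multiplied by `exp t` and squared. -/
theorem exp_sub_one_sq_le {t : ℝ} (ht : 0 ≤ t) : (Real.exp t - 1) ^ 2 ≤ t ^ 2 * Real.exp t ^ 2 := by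
  rw [← mul_pow]
  refine pow_le_pow_left₀ (by linarith [Real.add_one_le_exp t]) ?_ 2
  have h := Real.add_one_le_exp (-t)
  have h2 : Real.exp (-t) * Real.exp t = 1 := by rw [← Real.exp_add]; simp
  nlinarith [Real.exp_pos t]

theorem jacobi_resolvent_decay {lam q : ℕ → ℝ} {d : ℝ} {z : ℂ} (hlam : ∀ n, 0 < lam n)
    (hb : IsBoundedBelowBy (jacobiOp lam q) d) (htop : Tendsto lam atTop atTop) (hz : z.re < d)
    (u : (jacobiOp lam q).domain) (hu : jacobiOp lam q u - z • (u : EllTwo) = ellBasis 0)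
    {ε : ℝ} (hε0 : 0 < ε) (hε1 : ε < 1) :
    ∃ N : ℕ, ∀ n : ℕ, N < n → ‖(u : EllTwo) n‖ ≤ ((d - z.re) * ε)⁻¹ *
      Real.exp (-(1 - ε) * √(d - z.re) * ∑ k ∈ Finset.Ico N n, 1 / √(lam k)) := by
  set δ := d - z.re with hδ
  have hδ0 : 0 < δ := sub_pos.2 hz
  set c := (1 - ε) * √δ with hc
  have hc0 : 0 ≤ c := mul_nonneg (by linarith) (Real.sqrt_nonneg _)
  have hc2 : c ^ 2 = (1 - ε) ^ 2 * δ := by rw [hc, mul_pow, Real.sq_sqrt hδ0.le]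
  have hlim : Tendsto (fun n => Real.exp (c * (1 / √(lam n)))) atTop (𝓝 1) := by
    have h1 : Tendsto (fun n => 1 / √(lam n)) atTop (𝓝 0) := by
      simpa [Pi.inv_def, Function.comp_def] using (Real.tendsto_sqrt_atTop.comp htop).inv_tendsto_atTop
    simpa [Function.comp_def] using (Real.continuous_exp.tendsto _).comp (h1.const_mul c)
  -- Of the two factors `1 - ε` in `c²`, one absorbs `exp t` beyond `N`; the other stays in `κ`.
  obtain ⟨N, hN⟩ := eventually_atTop.1 (hlim.eventually_le_const
    (show (1 : ℝ) < (1 - ε)⁻¹ from (one_lt_inv₀ (by linarith)).2 (by linarith)))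
  refine ⟨N, fun n hn => ?_⟩
  -- Truncation at the target index `n` makes the weight eventually constant; the bound does not
  -- depend on the truncation.
  let φ : ℕ → ℝ := fun k => Real.exp (c * ∑ j ∈ Finset.Ico N (min k n), 1 / √(lam j))
  have hφ : ∀ k, φ k = Real.exp (c * ∑ j ∈ Finset.Ico N (min k n), 1 / √(lam j)) := fun _ => rfl
  -- With this `κ`, `δ - κ = δ * ε`, the prefactor of the claim.
  have hbound := norm_weight_mul_le (κ := (1 - ε) * δ) hlam hb u hu φ n
    (fun k => Real.exp_pos _) (by simp [hφ])
    (fun k hk => by rw [hφ, hφ, min_eq_right hk, min_self])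
    (mul_nonneg (by linarith) hδ0.le) (by nlinarith) (fun k => ?_) n
  · rw [hφ, min_self] at hbound
    have hexp : -(1 - ε) * √δ * ∑ k ∈ Finset.Ico N n, 1 / √(lam k) =
        -(c * ∑ k ∈ Finset.Ico N n, 1 / √(lam k)) := by rw [hc]; ring
    rw [hexp, Real.exp_neg, ← mul_inv, ← one_div,
      le_div_iff₀ (mul_pos (mul_pos hδ0 hε0) (Real.exp_pos _))]
    calc _ = (δ - (1 - ε) * δ) * (Real.exp (c * ∑ k ∈ Finset.Ico N n, 1 / √(lam k)) *
          ‖(u : EllTwo) n‖) := by ring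
      _ ≤ 1 := hbound
  · by_cases hk : N ≤ k ∧ k < n
    · have hstep : φ (k + 1) = φ k * Real.exp (c * (1 / √(lam k))) := by
        rw [hφ, hφ, min_eq_left hk.2.le, min_eq_left (by omega), Finset.sum_Ico_succ_top hk.1,
          mul_add, Real.exp_add]
      have hE := hN k hk.1
      set t := c * (1 / √(lam k)) with ht
      have ht0 : 0 ≤ t := by positivity
      have ht2 : lam k * t ^ 2 = (1 - ε) ^ 2 * δ := by
        have := (hlam k).ne'
        rw [ht, mul_pow, div_pow, Real.sq_sqrt (hlam k).le, hc2]
        field_simp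
      have hE' : (1 - ε) * Real.exp t ≤ 1 := by
        rwa [← one_div, le_div_iff₀' (by linarith)] at hE
      have hpos : 0 < φ k := Real.exp_pos _
      rw [hstep]
      calc lam k * (φ k * Real.exp t - φ k) ^ 2 = lam k * φ k ^ 2 * (Real.exp t - 1) ^ 2 := by ring
        _ ≤ lam k * φ k ^ 2 * (t ^ 2 * Real.exp t ^ 2) :=
          mul_le_mul_of_nonneg_left (exp_sub_one_sq_le ht0)
            (mul_nonneg (hlam k).le (sq_nonneg _))
        _ = (lam k * t ^ 2) * φ k ^ 2 * Real.exp t ^ 2 := by ring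
        _ = ((1 - ε) * Real.exp t) * ((1 - ε) * δ * φ k ^ 2 * Real.exp t) := by rw [ht2]; ring
        _ ≤ 1 * ((1 - ε) * δ * φ k ^ 2 * Real.exp t) := by
          refine mul_le_mul_of_nonneg_right hE' ?_
          have : 0 ≤ 1 - ε := by linarith
          positivity
        _ = _ := by ring
    · have hstep : φ (k + 1) = φ k := by
        rw [hφ, hφ]
        rcases not_and_or.1 hk with h | h
        · rw [Finset.Ico_eq_empty (by omega), Finset.Ico_eq_empty (by omega)]
        · rw [min_eq_right (by omega), min_eq_right (by omega)]
      have hpos : 0 < φ k := Real.exp_pos _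
      have : 0 ≤ 1 - ε := by linarith
      rw [hstep, sub_self]
      simp only [ne_eq, OfNat.ofNat_ne_zero, not_false_eq_true, zero_pow, mul_zero]
      positivity

/-! ### Self-adjointness from symmetry -/

/-- A summable sequence is infinitely often small compared with `1 / (n + 1)`. -/
theorem exists_frequently_mul_lt {a : ℕ → ℝ} (ha : Summable a) {η : ℝ}
    (hη : 0 < η) : ∃ᶠ n : ℕ in atTop, ((n : ℝ) + 1) * a n < η := by
  intro h
  obtain ⟨N, hN⟩ := eventually_atTop.1 h
  have h1 : Summable fun n : ℕ => η * (1 / ((n : ℝ) + 1)) := by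
    refine (summable_nat_add_iff N).1 (Summable.of_nonneg_of_le (fun n => by positivity)
      (fun n => ?_) ((summable_nat_add_iff N).2 ha))
    have h2 := not_lt.1 (hN (n + N) (by omega))
    rw [mul_one_div, div_le_iff₀ (by positivity), mul_comm]
    exact h2
  have h2 := (summable_mul_left_iff hη.ne').1 h1
  have h3 := (summable_nat_add_iff (f := fun n : ℕ => 1 / (n : ℝ)) 1).1 (by simpa using h2)
  exact Real.not_summable_one_div_natCast h3

theorem lp.summable_norm_mul_norm_succ (u v : EllTwo) :
    Summable fun n => ‖u n‖ * ‖v (n + 1)‖ := by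
  have hs : ∀ w : EllTwo, Summable fun n => ‖w n‖ ^ 2 := fun w => by
    have := (lp.hasSum_norm (p := 2) (by norm_num) w).summable
    norm_num at this
    exact this
  refine Summable.of_nonneg_of_le (fun n => by positivity) (fun n => ?_)
    ((hs u).add ((summable_nat_add_iff 1).2 (hs v)))
  nlinarith [sq_nonneg (‖u n‖ - ‖v (n + 1)‖), sq_nonneg ‖u n‖, sq_nonneg ‖v (n + 1)‖]

theorem jacobiOp_dense_domain (lam q : ℕ → ℝ) :
    Dense ((jacobiOp lam q).domain : Set EllTwo) := by
  rw [Submodule.dense_iff_topologicalClosure_eq_top, Submodule.topologicalClosure_eq_top_iff,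
    Submodule.eq_bot_iff]
  intro f hf
  refine lp.ext (funext fun n => ?_)
  rw [← inner_ellBasis_left]
  exact hf _ (ellBasis_mem_domain lam q n)

section Adjoint

variable {lam q : ℕ → ℝ}

/-- The maximal operator is self-adjoint as soon as it is symmetric. -/
theorem jacobiOp_isSelfAdjoint (h : (jacobiOp lam q).IsFormalAdjoint (jacobiOp lam q)) :
    IsSelfAdjoint (jacobiOp lam q) := by
  have hd := jacobiOp_dense_domain lam q
  rw [LinearPMap.isSelfAdjoint_def]
  refine le_antisymm ?_ (h.le_adjoint hd)
  -- Testing on basis vectors shows that the adjoint acts by the same expression, hence is contained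
  -- in the maximal operator.
  have key : ∀ u : (jacobiOp lam q).adjoint.domain,
      ⇑((jacobiOp lam q).adjoint u) = jacobiExpr lam q (u : EllTwo) := by
    intro u
    funext n
    have h1 := LinearPMap.adjoint_isFormalAdjoint hd u ⟨_, ellBasis_mem_domain lam q n⟩
    rw [inner_jacobiOp_ellBasis, ← inner_conj_symm, inner_ellBasis_left] at h1
    exact (starRingEnd ℂ).injective h1
  refine ⟨fun u hu => ?_, fun u v huv => ?_⟩
  · rw [mem_jacobiOp_domain, ← key ⟨u, hu⟩]
    exact lp.memℓp _
  · refine lp.ext ?_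
    rw [key, huv]
    rfl

end Adjoint

/-! ### The Laguerre operator -/

/-- The Jacobi operator with weights `n + 1` and potential `2 (n + 1)`: up to signs, the Laguerre
operator shifted by `1`. -/
noncomputable abbrev laguerreOp : EllTwo →ₗ.[ℂ] EllTwo :=
  jacobiOp (fun n : ℕ => (n : ℝ) + 1) (fun n : ℕ => 2 * ((n : ℝ) + 1))

/-- The boundary term in Lagrange's identity is at most `n + 1` times a summable sequence, hence
small infinitely often. The partial sums converge, so a subsequence suffices. -/
theorem laguerreOp_isFormalAdjoint : laguerreOp.IsFormalAdjoint laguerreOp := by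
  intro u v
  have hlim := ((tendsto_sum_conj_mul (u : EllTwo) (laguerreOp v)).sub
    (tendsto_sum_conj_mul (laguerreOp u) (v : EllTwo))).norm
  rw [eq_comm, ← sub_eq_zero, ← norm_le_zero_iff]
  refine le_of_forall_pos_le_add fun η hη => ?_
  rw [zero_add]
  refine le_of_tendsto_of_frequently hlim ?_
  refine (exists_frequently_mul_lt ((lp.summable_norm_mul_norm_succ (u : EllTwo) (v : EllTwo)).add
    (lp.summable_norm_mul_norm_succ (v : EllTwo) (u : EllTwo))) hη).mono fun n hn => ?_
  have hid := jacobiExpr_lagrange (fun n : ℕ => (n : ℝ) + 1) (fun n : ℕ => 2 * ((n : ℝ) + 1))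
    (v : EllTwo) (fun k => starRingEnd ℂ ((u : EllTwo) k)) n
  simp only [jacobiExpr_conj] at hid
  rw [← Finset.sum_sub_distrib]
  simp only [jacobiOp_coe_apply, mul_comm (starRingEnd ℂ (jacobiExpr _ _ _ _))]
  rw [hid, norm_mul]
  have h1 : ‖(((n : ℝ) + 1 : ℝ) : ℂ)‖ = (n : ℝ) + 1 := Complex.norm_of_nonneg (by positivity)
  rw [h1]
  refine le_trans (mul_le_mul_of_nonneg_left (norm_sub_le _ _) (by positivity)) ?_
  simp only [norm_mul, RCLike.norm_conj]
  rw [mul_comm ‖(u : EllTwo) (n + 1)‖]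
  exact hn.le

/-- Since `2(k + 1) - 1 = k + (k + 1)`, the diagonal of `J - 1` is exactly what completes the
squares on the two neighbouring bonds. This is where the lower bound `1` comes from. -/
theorem laguerre_form_identity (u : ℕ → ℂ) (n : ℕ) :
    ∑ k ∈ Finset.range (n + 1), (starRingEnd ℂ (u k) * (jacobiExpr (fun n : ℕ => (n : ℝ) + 1)
        (fun n : ℕ => 2 * ((n : ℝ) + 1)) u k - u k)).re =
      ∑ k ∈ Finset.range n, ((k : ℝ) + 1) * ‖u k + u (k + 1)‖ ^ 2 + (n + 1) * ‖u n‖ ^ 2 +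
        (n + 1) * (starRingEnd ℂ (u n) * u (n + 1)).re := by
  simp only [← Complex.normSq_eq_norm_sq, Complex.normSq_apply]
  induction n with
  | zero =>
    simp [jacobiExpr, Complex.mul_re, Complex.mul_im]
    ring
  | succ n ih =>
    rw [Finset.sum_range_succ, ih, Finset.sum_range_succ]
    simp [jacobiExpr, Complex.mul_re, Complex.mul_im]
    ring

theorem laguerreOp_isBoundedBelowBy : IsBoundedBelowBy laguerreOp 1 := by
  intro u
  have h3 : inner ℂ (u : EllTwo) (u : EllTwo) = ((‖(u : EllTwo)‖ ^ 2 : ℝ) : ℂ) := by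
    rw [inner_self_eq_norm_sq_to_K, Complex.ofReal_pow]; rfl
  have hlim := (Complex.continuous_re.tendsto _).comp
    (tendsto_sum_conj_mul (u : EllTwo) (laguerreOp u - (u : EllTwo)))
  rw [inner_sub_right, h3, Complex.sub_re, Complex.ofReal_re] at hlim
  rw [one_mul, ← sub_nonneg]
  refine le_of_forall_pos_le_add fun η hη => ?_
  rw [← sub_le_iff_le_add, zero_sub]
  refine ge_of_tendsto_of_frequently hlim ?_
  refine (exists_frequently_mul_lt (lp.summable_norm_mul_norm_succ (u : EllTwo) (u : EllTwo))
    hη).mono fun n hn => ?_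
  have hid := laguerre_form_identity (u : EllTwo) n
  rw [← Complex.re_sum] at hid
  refine le_trans ?_ hid.ge
  have h1 : -(‖(u : EllTwo) n‖ * ‖(u : EllTwo) (n + 1)‖) ≤
      (starRingEnd ℂ ((u : EllTwo) n) * (u : EllTwo) (n + 1)).re := by
    refine neg_le_of_abs_le ((Complex.abs_re_le_norm _).trans ?_)
    rw [norm_mul, RCLike.norm_conj]
  have h2 := mul_le_mul_of_nonneg_left h1 (show (0 : ℝ) ≤ (n : ℝ) + 1 by positivity)
  have h4 : 0 ≤ ∑ k ∈ Finset.range n,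
      ((k : ℝ) + 1) * ‖(u : EllTwo) k + (u : EllTwo) (k + 1)‖ ^ 2 :=
    Finset.sum_nonneg fun k _ => by positivity
  have h5 : 0 ≤ ((n : ℝ) + 1) * ‖(u : EllTwo) n‖ ^ 2 := by positivity
  linarith

/-! ### Laguerre polynomials at a negative argument -/

/-- The Laguerre polynomial of degree `n` at `-s`. -/
noncomputable def laguerreNeg (s : ℝ) (n : ℕ) : ℝ :=
  ∑ k ∈ Finset.range (n + 1), (n.choose k : ℝ) * s ^ k / (k.factorial : ℝ)

theorem laguerreNeg_eq_sum_range {s : ℝ} {n m : ℕ} (h : n < m) :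
    laguerreNeg s n = ∑ k ∈ Finset.range m, (n.choose k : ℝ) * s ^ k / (k.factorial : ℝ) := by
  refine Finset.sum_subset (Finset.range_mono h) fun k _ hk => ?_
  rw [Nat.choose_eq_zero_of_lt (by simpa using hk)]
  simp

theorem laguerreNeg_rec (s : ℝ) (n : ℕ) :
    ((n : ℝ) + 2) * laguerreNeg s (n + 2) + ((n : ℝ) + 1) * laguerreNeg s n =
      (2 * (n : ℝ) + 3 + s) * laguerreNeg s (n + 1) := by
  have h2 : laguerreNeg s (n + 1) = ∑ k ∈ Finset.range (n + 3),
      ((n + 1).choose k : ℝ) * s ^ k / (k.factorial : ℝ) := laguerreNeg_eq_sum_range (by omega)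
  -- Multiplication by `s` shifts the index. The factor `k * … / k` kills the term at `k = 0`, where
  -- `k - 1` is truncated, and cancels elsewhere.
  have h3 : s * laguerreNeg s (n + 1) = ∑ k ∈ Finset.range (n + 3),
      (k : ℝ) * (((n + 1).choose (k - 1) : ℝ) * s ^ k / ((k - 1).factorial : ℝ)) / k * 1 := by
    rw [Finset.sum_range_succ', laguerreNeg, Finset.mul_sum]
    simp only [Nat.cast_zero, zero_mul, zero_div, mul_one, add_zero]
    refine Finset.sum_congr rfl fun k _ => ?_
    have : ((k + 1 : ℕ) : ℝ) ≠ 0 := by positivity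
    rw [mul_div_cancel_left₀ _ this, Nat.add_sub_cancel, pow_succ]
    ring
  rw [add_mul (2 * (n : ℝ) + 3) s, h3, h2, laguerreNeg_eq_sum_range (show n + 2 < n + 3 by omega),
    laguerreNeg_eq_sum_range (show n < n + 3 by omega), Finset.mul_sum, Finset.mul_sum,
    Finset.mul_sum, ← Finset.sum_add_distrib, ← Finset.sum_add_distrib]
  refine Finset.sum_congr rfl fun k _ => ?_
  rcases k with _ | k
  · simp; ring
  have hk : ((k + 1 : ℕ) : ℝ) ≠ 0 := by positivity
  have hf : (k.factorial : ℝ) ≠ 0 := by positivity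
  rw [mul_div_cancel_left₀ _ hk, Nat.add_sub_cancel, Nat.factorial_succ]
  have e1 : ((n + 2).choose (k + 1) : ℝ) = (n + 1).choose k + (n + 1).choose (k + 1) := by
    exact_mod_cast Nat.choose_succ_succ (n + 1) k
  have e2 : ((n + 1).choose (k + 1) : ℝ) = n.choose k + n.choose (k + 1) := by
    exact_mod_cast Nat.choose_succ_succ n k
  have e3 : ((n : ℝ) + 1) * n.choose k + k * (n + 1).choose k = (n + 2 - 1) * (n + 1).choose k := by
    have h := Nat.add_one_mul_choose_eq n k
    have h' := Nat.choose_succ_right_eq (n + 1) k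
    rcases le_or_gt k (n + 1) with hkn | hkn
    · have h1 : ((n : ℝ) + 1) * n.choose k = (n + 1).choose (k + 1) * ((k : ℝ) + 1) := by
        exact_mod_cast h
      have h2 : ((n + 1).choose (k + 1) : ℝ) * ((k : ℝ) + 1) =
          (n + 1).choose k * ((n : ℝ) + 1 - k) := by
        have := congrArg (Nat.cast : ℕ → ℝ) h'
        push_cast [Nat.cast_sub hkn] at this
        exact this
      rw [h1, h2]; ring
    · rw [Nat.choose_eq_zero_of_lt hkn, Nat.choose_eq_zero_of_lt (show n < k by omega)]; simp
  push_cast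
  rw [e1]
  field_simp
  rw [e2] at *
  linear_combination (-(s ^ (k + 1))) * e3

theorem laguerreNeg_nonneg {s : ℝ} (hs : 0 ≤ s) (n : ℕ) : 0 ≤ laguerreNeg s n :=
  Finset.sum_nonneg fun k _ => by positivity

/-- From `n.choose k ≤ n ^ k / k!`, each term is at most the square of a term of the series of `exp
(√s * √n)`, and a sum of nonnegative squares is at most the square of the sum. -/
theorem laguerreNeg_le_exp {s : ℝ} (hs : 0 ≤ s) (n : ℕ) :
    laguerreNeg s n ≤ Real.exp (2 * (√s * √n)) := by
  have h1 : laguerreNeg s n ≤ ∑ k ∈ Finset.range (n + 1),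
      ((√s * √n) ^ k / (k.factorial : ℝ)) ^ 2 := by
    refine Finset.sum_le_sum fun k _ => ?_
    have h2 : (n.choose k : ℝ) ≤ (n : ℝ) ^ k / (k.factorial : ℝ) := Nat.choose_le_pow_div k n
    have h3 : ((√s * √n) ^ k / (k.factorial : ℝ)) ^ 2 =
        (n : ℝ) ^ k / (k.factorial : ℝ) * s ^ k / (k.factorial : ℝ) := by
      rw [div_pow, ← pow_mul, mul_comm k 2, pow_mul, mul_pow, Real.sq_sqrt hs,
        Real.sq_sqrt (Nat.cast_nonneg n), mul_pow]
      field_simp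
    rw [h3]
    gcongr
  have h2 : ∑ k ∈ Finset.range (n + 1), ((√s * √n) ^ k / (k.factorial : ℝ)) ^ 2 ≤
      (∑ k ∈ Finset.range (n + 1), (√s * √n) ^ k / (k.factorial : ℝ)) ^ 2 :=
    Finset.sum_sq_le_sq_sum_of_nonneg fun k _ => by positivity
  have h3 : ∑ k ∈ Finset.range (n + 1), (√s * √n) ^ k / (k.factorial : ℝ) ≤
      Real.exp (√s * √n) := Real.sum_le_exp_of_nonneg (by positivity) _
  rw [mul_comm 2, Real.exp_mul, Real.rpow_two]
  exact h1.trans (h2.trans (pow_le_pow_left₀ (Finset.sum_nonneg fun k _ => by positivity) h3 2))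

/-- The formal eigenvector of the Laguerre matrix below its spectrum. -/
theorem jacobiExpr_laguerreNeg (x : ℝ) (n : ℕ) :
    jacobiExpr (fun n : ℕ => (n : ℝ) + 1) (fun n : ℕ => 2 * ((n : ℝ) + 1))
      (fun n => (((-1) ^ n * laguerreNeg (1 - x) n : ℝ) : ℂ)) n =
      x * (((-1) ^ n * laguerreNeg (1 - x) n : ℝ) : ℂ) := by
  cases n with
  | zero =>
    simp [jacobiExpr, laguerreNeg, Finset.sum_range_succ]
    ring
  | succ n =>
    have h := congrArg (fun t : ℝ => (t : ℂ)) (laguerreNeg_rec (1 - x) n)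
    simp only [jacobiExpr]
    push_cast at h ⊢
    simp only [pow_succ]
    linear_combination (-1 : ℂ) ^ n * h

/-! ### Sharpness -/

/-- Both sequences satisfy the equation at `x` except for the source `e₀` of `u`, so the Lagrange
sum collapses to `p 0 = 1`. -/
theorem laguerre_wronskian {x : ℝ} (hx : x ≤ 1) (u : laguerreOp.domain)
    (hu : laguerreOp u - (x : ℂ) • (u : EllTwo) = ellBasis 0) (n : ℕ) :
    1 ≤ ((n : ℝ) + 1) * (laguerreNeg (1 - x) n * ‖(u : EllTwo) (n + 1)‖ +
      laguerreNeg (1 - x) (n + 1) * ‖(u : EllTwo) n‖) := by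
  set p : ℕ → ℂ := fun n => (((-1) ^ n * laguerreNeg (1 - x) n : ℝ) : ℂ) with hp
  have hJu : ∀ k, jacobiExpr (fun n : ℕ => (n : ℝ) + 1) (fun n : ℕ => 2 * ((n : ℝ) + 1))
      (u : EllTwo) k = (if k = 0 then 1 else 0) + x * (u : EllTwo) k := by
    intro k
    have h : (laguerreOp u : EllTwo) k = _ :=
      congrArg (fun f : EllTwo => f k) (sub_eq_iff_eq_add.1 hu)
    rw [jacobiOp_coe_apply] at h
    rw [h, lp.coeFn_add, lp.coeFn_smul, Pi.add_apply, Pi.smul_apply, ellBasis_apply, smul_eq_mul]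
  have hp0 : p 0 = 1 := by simp [hp, laguerreNeg]
  have hpn : ∀ k, ‖p k‖ = laguerreNeg (1 - x) k := fun k => by
    rw [hp, Complex.norm_real, norm_mul, norm_pow, norm_neg, norm_one, one_pow, one_mul,
      Real.norm_of_nonneg (laguerreNeg_nonneg (by linarith) k)]
  have h := jacobiExpr_lagrange (fun n : ℕ => (n : ℝ) + 1) (fun n : ℕ => 2 * ((n : ℝ) + 1))
    (u : EllTwo) p n
  have hsum : ∑ k ∈ Finset.range (n + 1), (p k * jacobiExpr (fun n : ℕ => (n : ℝ) + 1)
      (fun n : ℕ => 2 * ((n : ℝ) + 1)) (u : EllTwo) k - (u : EllTwo) k *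
      jacobiExpr (fun n : ℕ => (n : ℝ) + 1) (fun n : ℕ => 2 * ((n : ℝ) + 1)) p k) = 1 := by
    have h1 : ∀ k, p k * ((if k = 0 then 1 else 0) + x * (u : EllTwo) k) -
        (u : EllTwo) k * (x * p k) = if k = 0 then 1 else 0 := fun k => by
      split_ifs with hk
      · rw [hk, hp0]; ring
      · ring
    simp only [hJu, hp, jacobiExpr_laguerreNeg]
    simp only [hp] at h1
    simp only [h1]
    simp
  have h2 := congrArg norm (hsum.symm.trans h)
  have h3 : ‖(((n : ℝ) + 1 : ℝ) : ℂ)‖ = (n : ℝ) + 1 := Complex.norm_of_nonneg (by positivity)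
  rw [norm_one, norm_mul, h3] at h2
  rw [← hpn, ← hpn, ← norm_mul, ← norm_mul]
  refine h2.trans_le ?_
  exact mul_le_mul_of_nonneg_left (norm_sub_le _ _) (by positivity)

theorem sum_one_div_sqrt_ge {N n : ℕ} (h : N ≤ n) :
    2 * √((n : ℝ) + 1) - 2 * √((N : ℝ) + 1) ≤
      ∑ k ∈ Finset.Ico N n, 1 / √((k : ℝ) + 1) := by
  induction n, h using Nat.le_induction with
  | base => simp
  | succ n hn ih =>
    rw [Finset.sum_Ico_succ_top hn]
    have h1 : 0 < √((n : ℝ) + 1) := Real.sqrt_pos.2 (by positivity)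
    have h2 : √((n : ℝ) + 1) ^ 2 = (n : ℝ) + 1 := Real.sq_sqrt (by positivity)
    have h3 : √(((n + 1 : ℕ) : ℝ) + 1) ^ 2 = (n : ℝ) + 2 := by
      rw [Real.sq_sqrt (by positivity)]; push_cast; ring
    have h4 : 2 * √(((n + 1 : ℕ) : ℝ) + 1) - 2 * √((n : ℝ) + 1) ≤ 1 / √((n : ℝ) + 1) := by
      rw [le_div_iff₀ h1]
      nlinarith [sq_nonneg (√(((n + 1 : ℕ) : ℝ) + 1) - √((n : ℝ) + 1))]
    linarith

theorem laguerre_resolvent_not_faster {x : ℝ} (hx : x < 1) (u : laguerreOp.domain)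
    (hu : laguerreOp u - (x : ℂ) • (u : EllTwo) = ellBasis 0) {ε : ℝ} (hε : 0 < ε) (C : ℝ)
    (N : ℕ) (h : ∀ n : ℕ, N < n → ‖(u : EllTwo) n‖ ≤ C * Real.exp (-(1 + ε) * √(1 - x) *
      ∑ k ∈ Finset.Ico N n, 1 / √((k : ℝ) + 1))) : False := by
  have hs : 0 < √(1 - x) := Real.sqrt_pos.2 (by linarith)
  have hs1 : 0 ≤ 1 - x := by linarith
  have hC : 0 ≤ C := nonneg_of_mul_nonneg_left ((norm_nonneg _).trans (h (N + 1) (by omega)))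
    (Real.exp_pos _)
  set a := √(1 - x) with ha
  -- The `2` counts the two Wronskian terms; the exponential comes from the lower endpoint `N` of
  -- the sum.
  set K := 2 * C * Real.exp (2 * (1 + ε) * a * √((N : ℝ) + 1)) with hK
  -- A bound in terms of `n` for all `m ≥ n` serves both `u n` and `u (n + 1)`.
  have hu_le : ∀ n : ℕ, N < n → ∀ m, n ≤ m → ‖(u : EllTwo) m‖ ≤
      C * Real.exp (-(1 + ε) * a * (2 * √((n : ℝ) + 1) - 2 * √((N : ℝ) + 1))) := by
    intro n hn m hm
    refine (h m (by omega)).trans (mul_le_mul_of_nonneg_left (Real.exp_le_exp.2 ?_) hC)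
    have h1 := sum_one_div_sqrt_ge (show N ≤ m by omega)
    have h2 : √((n : ℝ) + 1) ≤ √((m : ℝ) + 1) := Real.sqrt_le_sqrt (by gcongr)
    have h3 : 0 ≤ (1 + ε) * a := by positivity
    have h4 := mul_le_mul_of_nonneg_left ((sub_le_sub_right
      (mul_le_mul_of_nonneg_left h2 zero_le_two) (2 * √((N : ℝ) + 1))).trans h1) h3
    linarith
  have hp_le : ∀ n m : ℕ, m ≤ n + 1 → laguerreNeg (1 - x) m ≤
      Real.exp (2 * (a * √((n : ℝ) + 1))) := by
    intro n m hm
    refine (laguerreNeg_le_exp hs1 m).trans (Real.exp_le_exp.2 ?_)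
    have h1 : √(m : ℝ) ≤ √((n : ℝ) + 1) := Real.sqrt_le_sqrt (by exact_mod_cast hm)
    gcongr
  -- Growth `2a√(n+1)` against decay `2(1+ε)a√(n+1)` leaves a right side that tends to `0`. The
  -- exponent `2` is real to fit the limit lemma.
  have hbound : ∀ n : ℕ, N < n → 1 ≤
      K * (√((n : ℝ) + 1) ^ (2 : ℝ) * Real.exp (-(2 * ε * a) * √((n : ℝ) + 1))) := by
    intro n hn
    refine (laguerre_wronskian hx.le u hu n).trans ?_
    set y := √((n : ℝ) + 1) with hy
    have hy2 : (n : ℝ) + 1 = y ^ (2 : ℝ) := by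
      rw [Real.rpow_two, hy, Real.sq_sqrt (by positivity)]
    calc _ ≤ ((n : ℝ) + 1) * (Real.exp (2 * (a * y)) *
            (C * Real.exp (-(1 + ε) * a * (2 * y - 2 * √((N : ℝ) + 1)))) +
          Real.exp (2 * (a * y)) *
            (C * Real.exp (-(1 + ε) * a * (2 * y - 2 * √((N : ℝ) + 1))))) := by
          refine mul_le_mul_of_nonneg_left (add_le_add ?_ ?_) (by positivity)
          · exact mul_le_mul (hp_le n n (by omega)) (hu_le n hn _ (by omega)) (norm_nonneg _)
              (Real.exp_pos _).le
          · exact mul_le_mul (hp_le n _ le_rfl) (hu_le n hn _ le_rfl) (norm_nonneg _)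
              (Real.exp_pos _).le
      _ = ((n : ℝ) + 1) * (2 * C) * (Real.exp (2 * (a * y)) *
            Real.exp (-(1 + ε) * a * (2 * y - 2 * √((N : ℝ) + 1)))) := by ring
      _ = ((n : ℝ) + 1) * (2 * C) * (Real.exp (2 * (1 + ε) * a * √((N : ℝ) + 1)) *
            Real.exp (-(2 * ε * a) * y)) := by
          rw [← Real.exp_add, ← Real.exp_add]
          ring_nf
      _ = _ := by rw [hy2, hK]; ring
  have hlim := ((tendsto_rpow_mul_exp_neg_mul_atTop_nhds_zero 2 (2 * ε * a)
    (by positivity)).comp (Real.tendsto_sqrt_atTop.comp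
      (tendsto_atTop_add_const_right atTop (1 : ℝ) tendsto_natCast_atTop_atTop))).const_mul K
  have := ge_of_tendsto hlim ((eventually_gt_atTop N).mono hbound)
  norm_num at this
theorem theorem2p3 :
    -- the decay bound
    (∀ (lam q : ℕ → ℝ) (d : ℝ), (∀ n, 0 < lam n) →
      IsSelfAdjoint (jacobiOp lam q) →
      IsBoundedBelowBy (jacobiOp lam q) d →
      Filter.Tendsto lam Filter.atTop Filter.atTop →
      ∀ z : ℂ, z.re < d →
        ∃ R : EllTwo →L[ℂ] EllTwo, IsResolventOf (jacobiOp lam q) z R ∧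
          ∀ ε : ℝ, 0 < ε → ε < 1 → ∃ N : ℕ, ∀ n : ℕ, N < n →
            ‖inner ℂ (R (ellBasis 0)) (ellBasis n)‖ ≤
              ((d - z.re) * ε)⁻¹ *
                Real.exp (-(1 - ε) * √(d - z.re) * ∑ k ∈ Finset.Ico N n, 1 / √(lam k))) ∧
    -- sharpness: for an explicit Jacobi matrix with lower bound `1` which satisfies all the
    -- hypotheses, no factor `1 + ε` is possible, at any real point below `1`
    (∃ lam q : ℕ → ℝ, lam = (fun n : ℕ => (n : ℝ) + 1) ∧ q = (fun n : ℕ => 2 * ((n : ℝ) + 1)) ∧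
      (∀ n, 0 < lam n) ∧
      IsSelfAdjoint (jacobiOp lam q) ∧
      IsBoundedBelowBy (jacobiOp lam q) 1 ∧
      Filter.Tendsto lam Filter.atTop Filter.atTop ∧
      ∀ x : ℝ, x < 1 →
        ∃ R : EllTwo →L[ℂ] EllTwo, IsResolventOf (jacobiOp lam q) (x : ℂ) R ∧
          ∀ ε : ℝ, 0 < ε → ¬ ∃ (C : ℝ) (N : ℕ), ∀ n : ℕ, N < n →
            ‖inner ℂ (R (ellBasis 0)) (ellBasis n)‖ ≤
              C * Real.exp (-(1 + ε) * √(1 - x) * ∑ k ∈ Finset.Ico N n, 1 / √(lam k))) := by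
  refine ⟨fun lam q d hlam _ hb htop z hz => ?_, _, _, rfl, rfl, fun n => by positivity,
    jacobiOp_isSelfAdjoint laguerreOp_isFormalAdjoint, laguerreOp_isBoundedBelowBy,
    Filter.tendsto_atTop_add_const_right _ _ tendsto_natCast_atTop_atTop, fun x hx => ?_⟩
  · obtain ⟨R, hR⟩ := exists_isResolventOf hb hz
    refine ⟨R, hR, fun ε hε0 hε1 => ?_⟩
    obtain ⟨hmem, hu⟩ := hR.1 (ellBasis 0)
    simp only [norm_inner_ellBasis_right]
    exact jacobi_resolvent_decay hlam hb htop hz ⟨_, hmem⟩ hu hε0 hε1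
  · obtain ⟨R, hR⟩ := exists_isResolventOf (z := x) laguerreOp_isBoundedBelowBy hx
    refine ⟨R, hR, fun ε hε => ?_⟩
    rintro ⟨C, N, h⟩
    obtain ⟨hmem, hu⟩ := hR.1 (ellBasis 0)
    simp only [norm_inner_ellBasis_right] at h
    exact laguerre_resolvent_not_faster hx ⟨_, hmem⟩ hu hε C N h
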